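/- Let $N_1, N_2 > 1$ be integers, let $(K, D)$ be a differential field (a field with a derivation $D$) of characteristic $p \ge 0$, and let $F \supseteq K$ be a differential field extension, i.e. a field extension with a derivation, again denoted $D$, that extends the one of $K$. Let $L_1(Y) = \sum_{i=0}^{N_1} a_i D^iY$ and $L_2(Y) = \sum_{i=0}^{N_2} b_i D^iY$ be homogeneous linear differential polynomials with coefficients in $K$, of orders exactly $N_1$ and $N_2$ (that is, $a_{N_1} \ne 0$ and $b_{N_2} \ne 0$). Let $y \in F$ with $y \neq 0$, and suppose that one of the following holds: 1. $p = 0$ or $p > N_1+N_2-2$, and $L_1(y) = L_2(1/y) = 0$; 2. $q$ is a positive integer with $N_2 \le q$, $p = 0$ or $p > (q+1)(N_1-1)-1$, and $L_1(y) = L_2(y^q) = 0$. Then $D^jy/y$ is algebraic over $K$ for every $j \ge 1$. Moreover, for $j = 1, \dots, N_1-1$, the degree of the minimal polynomial of $D^jy/y$ over $K$ is at most $$\frac{(N_2+N_1-2)!}{(N_2-1)!} \text{ in case (1)}, \qquad \frac{(q(N_1-1)+N_1-2)!}{(q(N_1-1)-1)!} \text{ in case (2)}.$$ -/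

import Mathlib

open scoped Nat

/-- A homogeneous linear differential polynomial `a₀ Y + a₁ DY + ⋯ + a_N D^N Y` in one differential
indeterminate `Y`, with coefficients in `K`, stored as its finitely supported family of
coefficients: `L.coeff i` is the coefficient of `D^i Y`. -/
@[ext]
structure HomLinDiffPoly (K : Type*) [Field K] where
  coeff : ℕ →₀ K

namespace HomLinDiffPoly

/-- `L` is nonzero of order `N`: the highest derivative that occurs in `L` with a nonzero
coefficient is `D^N Y`. -/
def HasOrder {K : Type*} [Field K] (L : HomLinDiffPoly K) (N : ℕ) : Prop :=
  L.coeff N ≠ 0 ∧ ∀ i, N < i → L.coeff i = 0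

end HomLinDiffPoly

/-- The `j`-th iterate `D^j y` of the derivation of a differential field. -/
def iterD {F : Type*} [Field F] [Differential F] (j : ℕ) (y : F) : F :=
  (fun z : F => Differential.deriv z)^[j] y

namespace HomLinDiffPoly

/-- The value `L(y) = ∑ᵢ aᵢ D^i y` at an element `y` of an extension field. -/
def eval {K F : Type*} [Field K] [Field F] [Differential F] [Algebra K F]
    (L : HomLinDiffPoly K) (y : F) : F :=
  L.coeff.sum fun i a => algebraMap K F a * iterD i y

end HomLinDiffPoly

/-! Put ξ_k = D^k y / (k! y), X = ∑ ξ_k T^k, n = N₁ - 1. By Leibniz, wherever the factorials are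
invertible, products of elements become products of such series, so 1/y and y^q correspond to X⁻¹
and X^q. A linear equation puts the coefficients of its solution's series in the K-span of the first
few. Hence `L₁` leaves ξ_1, …, ξ_n as generators, and `L₂` yields polynomial relations among them.

Finiteness is a leading-term argument: if, for suitable weights, each generator's power x_i^{e_i} is
a combination of monomials of smaller weight, then the ∏ e_i monomials with exponents below e_i span
everything, which bounds degrees (`isIntegral_and_natDegree_minpoly_le_prod`).

For y^q, strictly concave weights make ξ_j^q the leading term of coefficient qj of X^q; this gives
q^n, which is below the stated bound. For 1/y, factor the truncation of X as ∏ (1 - t_i T) over an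
algebraic closure. Up to lower degree, the coefficients of X⁻¹ are the complete homogeneous
polynomials h_k(t). The relations eliminate variables one by one and yield leading powers
t_i^(N₂+n-1-i), whose exponents multiply to the descending factorial. -/

/-! ### Weight filtrations and reduction of monomials -/

section WeightFiltration

variable (K : Type*) {A ι : Type*} [Field K] [CommRing A] [Algebra K A] [Fintype ι]

/-- The `K`-span of the monomials in the family `x` whose weight with respect to `w` is less
than `d`. -/
def weightFiltration (x : ι → A) (w : ι → ℕ) (d : ℕ) : Submodule K A :=
  Submodule.span K {z | ∃ b : ι → ℕ, ∑ i, b i * w i < d ∧ z = ∏ i, x i ^ b i}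

variable {K} {x : ι → A} {w : ι → ℕ}

theorem weightFiltration_le_of_weight {w' : ι → ℕ} {d d' : ℕ}
    (h : ∀ b : ι → ℕ, ∑ i, b i * w i < d → ∑ i, b i * w' i < d') :
    weightFiltration K x w d ≤ weightFiltration K x w' d' := by
  refine Submodule.span_mono ?_
  rintro z ⟨b, hb, rfl⟩
  exact ⟨b, h b hb, rfl⟩

theorem weightFiltration_mono {d d' : ℕ} (h : d ≤ d') :
    weightFiltration K x w d ≤ weightFiltration K x w d' :=
  weightFiltration_le_of_weight fun _ hb => hb.trans_le h

theorem one_mem_weightFiltration (d : ℕ) : (1 : A) ∈ weightFiltration K x w (d + 1) :=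
  Submodule.subset_span ⟨0, by simp, by simp⟩

theorem self_mem_weightFiltration (i : ι) : x i ∈ weightFiltration K x w (w i + 1) := by
  classical
  refine Submodule.subset_span ⟨Pi.single i 1, ?_, ?_⟩
  · simp [Pi.single_apply]
  · simp [Pi.single_apply, pow_ite]

/-- Index `d` means weight strictly below `d`, so `a + 1` encodes the weak bound `a`: a weak bound
times a strict one is strict. -/
theorem mul_mem_weightFiltration {a b : ℕ} {u v : A}
    (hu : u ∈ weightFiltration K x w (a + 1)) (hv : v ∈ weightFiltration K x w b) :
    u * v ∈ weightFiltration K x w (a + b) := by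
  have h := Submodule.mul_mem_mul hu hv
  rw [weightFiltration, weightFiltration, Submodule.span_mul_span] at h
  refine Submodule.span_mono ?_ h
  rintro _ ⟨_, ⟨b₁, h₁, rfl⟩, _, ⟨b₂, h₂, rfl⟩, rfl⟩
  refine ⟨b₁ + b₂, ?_, ?_⟩
  · simp only [Pi.add_apply, add_mul, Finset.sum_add_distrib]
    omega
  · simp [pow_add, Finset.prod_mul_distrib]

theorem mul_mem_weightFiltration' {a b : ℕ} {u v : A}
    (hu : u ∈ weightFiltration K x w a) (hv : v ∈ weightFiltration K x w (b + 1)) :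
    u * v ∈ weightFiltration K x w (a + b) := by
  rw [mul_comm, add_comm]
  exact mul_mem_weightFiltration hv hu

theorem pow_mem_weightFiltration {a : ℕ} {u : A} (hu : u ∈ weightFiltration K x w (a + 1))
    (k : ℕ) : u ^ k ∈ weightFiltration K x w (k * a + 1) := by
  induction k with
  | zero => simpa using one_mem_weightFiltration (K := K) (x := x) (w := w) 0
  | succ k ih =>
    rw [pow_succ]
    exact weightFiltration_mono (le_of_eq (by ring))
      (mul_mem_weightFiltration ih hu)

/-- If each `x i ^ e i` is a combination of monomials of smaller weight, then all monomials are
combinations of those with exponents below `e`. -/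
theorem weightFiltration_le_span {e : ι → ℕ}
    (h : ∀ i, x i ^ e i ∈ weightFiltration K x w (e i * w i)) (d : ℕ) :
    weightFiltration K x w d ≤
      Submodule.span K (Set.range fun a : (i : ι) → Fin (e i) => ∏ i, x i ^ (a i : ℕ)) := by
  classical
  induction d with
  | zero =>
    refine Submodule.span_le.2 ?_
    rintro z ⟨b, hb, rfl⟩
    simp at hb
  | succ d ih =>
    refine Submodule.span_le.2 ?_
    rintro z ⟨b, hb, rfl⟩
    by_cases hs : ∀ i, b i < e i
    · exact Submodule.subset_span ⟨fun i => ⟨b i, hs i⟩, rfl⟩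
    push Not at hs
    obtain ⟨i, hi⟩ := hs
    -- Split off `x i ^ e i`; replacing it by terms of smaller weight brings the whole monomial
    -- within reach of the induction.
    have hdec : b = Function.update b i (b i - e i) + Pi.single i (e i) := by
      ext j
      rcases eq_or_ne j i with rfl | hj
      · simp; omega
      · simp [hj]
    set b' := Function.update b i (b i - e i)
    have hprod : ∏ j, x j ^ b j = (∏ j, x j ^ b' j) * x i ^ e i := by
      simp_rw [congrFun hdec, Pi.add_apply, pow_add, Finset.prod_mul_distrib]
      simp [Pi.single_apply, pow_ite]
    have hsum : ∑ j, b j * w j = ∑ j, b' j * w j + e i * w i := by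
      rw [hdec]
      simp [add_mul, Finset.sum_add_distrib, Pi.single_apply]
    rw [hprod]
    have h1 : ∏ j, x j ^ b' j ∈ weightFiltration K x w (∑ j, b' j * w j + 1) :=
      Submodule.subset_span ⟨b', by simp, rfl⟩
    exact ih (weightFiltration_mono (by omega) (mul_mem_weightFiltration h1 (h i)))

end WeightFiltration

/-! ### Degree bounds from finite-dimensional spans -/

section Degree

variable {K A ι : Type*} [Field K] [Field A] [Algebra K A]

theorem isIntegral_and_natDegree_minpoly_le_finrank (S : Submodule K A) [FiniteDimensional K S]
    {z : A} (hz : ∀ k : ℕ, z ^ k ∈ S) :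
    IsIntegral K z ∧ (minpoly K z).natDegree ≤ Module.finrank K S := by
  constructor
  · refine IsIntegral.of_mem_of_fg (Algebra.adjoin K {z}) ?_ z
      (Algebra.self_mem_adjoin_singleton K z)
    have hle : Subalgebra.toSubmodule (Algebra.adjoin K {z}) ≤ S := by
      rw [Algebra.adjoin_eq_span, Submodule.span_le]
      intro u hu
      obtain ⟨k, rfl⟩ := Submonoid.mem_closure_singleton.1 hu
      exact hz k
    have := Submodule.finiteDimensional_of_le hle
    exact Module.Finite.iff_fg.1 this
  · have hli : LinearIndependent K
        (fun i : Fin (minpoly K z).natDegree => (⟨z ^ (i : ℕ), hz i⟩ : S)) :=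
      LinearIndependent.of_comp S.subtype (linearIndependent_pow z)
    simpa using hli.fintype_card_le_finrank

theorem isIntegral_and_natDegree_minpoly_le_prod [Fintype ι] {x : ι → A} {w e : ι → ℕ}
    (h : ∀ i, x i ^ e i ∈ weightFiltration K x w (e i * w i)) {d : ℕ} {z : A}
    (hz : z ∈ weightFiltration K x w d) :
    IsIntegral K z ∧ (minpoly K z).natDegree ≤ ∏ i, e i := by
  classical
  set S := Submodule.span K (Set.range fun a : (i : ι) → Fin (e i) => ∏ i, x i ^ (a i : ℕ))
  have : FiniteDimensional K S := FiniteDimensional.span_of_finite K (Set.finite_range _)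
  have hS : Module.finrank K S ≤ ∏ i, e i := by
    refine (finrank_range_le_card _).trans ?_
    simp
  have hz' : ∀ k : ℕ, z ^ k ∈ S := fun k =>
    weightFiltration_le_span h _
      (pow_mem_weightFiltration (weightFiltration_mono (Nat.le_succ d) hz) k)
  obtain ⟨h1, h2⟩ := isIntegral_and_natDegree_minpoly_le_finrank S hz'
  exact ⟨h1, h2.trans hS⟩

end Degree

/-! ### Divided logarithmic derivatives and linear equations -/

section DividedDerivatives

variable {F : Type*} [Field F] [Differential F]

theorem iterD_succ (k : ℕ) (y : F) : iterD (k + 1) y = Differential.deriv (iterD k y) :=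
  Function.iterate_succ_apply' _ _ _

theorem iterD_mul (k : ℕ) (a b : F) :
    iterD k (a * b) =
      ∑ ij ∈ Finset.HasAntidiagonal.antidiagonal k,
        (k.choose ij.1 : F) * (iterD ij.1 a * iterD ij.2 b) := by
  induction k with
  | zero => simp [iterD]
  | succ k ih =>
    rw [Finset.sum_antidiagonal_choose_succ_mul (fun i j => iterD i a * iterD j b), iterD_succ,
      ih, map_sum, ← Finset.sum_add_distrib]
    refine Finset.sum_congr rfl fun ij hij => ?_
    rw [Finset.HasAntidiagonal.mem_antidiagonal] at hij
    rw [Derivation.leibniz, Derivation.leibniz, Derivation.map_natCast, iterD_succ, iterD_succ,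
      Nat.choose_symm_of_eq_add hij.symm]
    simp only [smul_eq_mul]
    ring

/-- The logarithmic divided derivative `D^k y / (k! y)`, a junk value if `k! = 0` in `F`. -/
def dividedLogDeriv (y : F) (k : ℕ) : F := iterD k y / y / (k ! : F)

theorem dividedLogDeriv_zero {y : F} (hy : y ≠ 0) : dividedLogDeriv y 0 = 1 := by
  simp [dividedLogDeriv, iterD, hy]

theorem iterD_one {k : ℕ} (hk : k ≠ 0) : iterD k (1 : F) = 0 := by
  obtain ⟨k, rfl⟩ := Nat.exists_eq_succ_of_ne_zero hk
  induction k with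
  | zero => simp [iterD]
  | succ k ih => rw [iterD_succ, ih (by simp), map_zero]

theorem dividedLogDeriv_one {k : ℕ} (hk : k ≠ 0) : dividedLogDeriv (1 : F) k = 0 := by
  simp [dividedLogDeriv, iterD_one hk]

theorem dividedLogDeriv_mul {a b : F} (ha : a ≠ 0) (hb : b ≠ 0) {k : ℕ} (hk : (k ! : F) ≠ 0) :
    dividedLogDeriv (a * b) k =
      ∑ ij ∈ Finset.HasAntidiagonal.antidiagonal k,
        dividedLogDeriv a ij.1 * dividedLogDeriv b ij.2 := by
  rw [dividedLogDeriv, iterD_mul, Finset.sum_div, Finset.sum_div]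
  refine Finset.sum_congr rfl fun ij hij => ?_
  rw [Finset.HasAntidiagonal.mem_antidiagonal] at hij
  obtain ⟨i, j⟩ := ij
  subst hij
  have hch : (((i + j).choose i : ℕ) : F) * (i ! : F) * (j ! : F) = ((i + j)! : F) := by
    rw [Nat.choose_symm_add]
    exact_mod_cast congrArg (Nat.cast (R := F)) 
      (Nat.add_choose_mul_factorial_mul_factorial i j)
  rw [← hch] at hk ⊢
  have h1 : (i ! : F) ≠ 0 := fun h => hk (by simp [h])
  have h2 : (j ! : F) ≠ 0 := fun h => hk (by simp [h])
  have h3 : (((i + j).choose i : ℕ) : F) ≠ 0 := fun h => hk (by simp [h])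
  simp only [dividedLogDeriv]
  field_simp

theorem dividedLogDeriv_pow {y : F} (hy : y ≠ 0) {B : ℕ} (hB : ∀ k ≤ B, (k ! : F) ≠ 0) (q : ℕ)
    {k : ℕ} (hk : k ≤ B) :
    dividedLogDeriv (y ^ q) k =
      PowerSeries.coeff k (PowerSeries.mk (dividedLogDeriv y) ^ q) := by
  induction q generalizing k with
  | zero =>
    rcases eq_or_ne k 0 with rfl | h
    · simp [dividedLogDeriv_zero]
    · simp [dividedLogDeriv_one h, PowerSeries.coeff_one, h]
  | succ q ih =>
    rw [pow_succ, pow_succ, dividedLogDeriv_mul (pow_ne_zero q hy) hy (hB k hk),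
      PowerSeries.coeff_mul]
    refine Finset.sum_congr rfl fun ij hij => ?_
    rw [Finset.HasAntidiagonal.mem_antidiagonal] at hij
    rw [ih (by omega), PowerSeries.coeff_mk]

variable {K : Type*} [Field K] [Differential K] [Algebra K F] [DifferentialAlgebra K F]

/-- The equation solves for `D^N y`, so the span of the lower derivatives is stable under the
derivation. -/
theorem iterD_mem_span {L : HomLinDiffPoly K} {N : ℕ} (hL : L.HasOrder N) {y : F}
    (hy : L.eval y = 0) (k : ℕ) :
    iterD k y ∈ Submodule.span K ((fun i => iterD i y) '' Set.Iio N) := by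
  set W := Submodule.span K ((fun i => iterD i y) '' Set.Iio N)
  have hmem : ∀ i < N, iterD i y ∈ W := fun i hi => Submodule.subset_span ⟨i, hi, rfl⟩
  have hN : iterD N y ∈ W := by
    have hsum : L.eval y = ∑ i ∈ Finset.range (N + 1), L.coeff i • iterD i y := by
      rw [HomLinDiffPoly.eval, Finsupp.sum_of_support_subset (s := Finset.range (N + 1))]
      · simp [Algebra.smul_def]
      · intro i hi
        rw [Finset.mem_range]
        by_contra h
        exact Finsupp.mem_support_iff.1 hi (hL.2 i (by omega))
      · simp
    rw [hy, Finset.sum_range_succ] at hsum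
    refine (Submodule.smul_mem_iff W hL.1).1 ?_
    rw [← neg_eq_of_add_eq_zero_right hsum.symm]
    exact W.neg_mem (W.sum_mem fun i hi =>
      W.smul_mem _ (hmem i (Finset.mem_range.1 hi)))
  have hD : ∀ u ∈ W, Differential.deriv u ∈ W := by
    intro u hu
    induction hu using Submodule.span_induction with
    | mem u hu =>
      obtain ⟨i, hi, rfl⟩ := hu
      change Differential.deriv (iterD i y) ∈ W
      rw [← iterD_succ]
      rcases Nat.lt_or_ge (i + 1) N with h | h
      · exact hmem _ h
      · rwa [show i + 1 = N from le_antisymm hi h]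
    | zero => rw [map_zero]; exact W.zero_mem
    | add u v _ _ hu hv => rw [map_add]; exact W.add_mem hu hv
    | smul a u hu' hu =>
      rw [Algebra.smul_def, Derivation.leibniz, DifferentialAlgebra.deriv_algebraMap]
      simp only [smul_eq_mul]
      rw [mul_comm u, ← Algebra.smul_def, ← Algebra.smul_def]
      exact W.add_mem (W.smul_mem _ hu) (W.smul_mem _ hu')
  induction k with
  | zero =>
    rcases Nat.eq_zero_or_pos N with h | h
    · rwa [h] at hN
    · exact hmem 0 h
  | succ k ih => rw [iterD_succ]; exact hD _ ih

/-- A `K`-subspace containing the first `N` logarithmic divided derivatives of a solution of a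
linear equation of order `N` contains all quotients `D^k y / y`. -/
theorem iterD_div_mem {L : HomLinDiffPoly K} {N : ℕ} (hL : L.HasOrder N) {y : F}
    (hy : L.eval y = 0) (hfac : ∀ i < N, (i ! : K) ≠ 0) {P : Submodule K F}
    (hP : ∀ i < N, dividedLogDeriv y i ∈ P) (k : ℕ) : iterD k y / y ∈ P := by
  have h : Submodule.span K ((fun i => iterD i y) '' Set.Iio N) ≤
      P.comap (LinearMap.mulRight K y⁻¹) := by
    rw [Submodule.span_le]
    rintro _ ⟨i, hi, rfl⟩
    refine (Submodule.smul_mem_iff P (inv_ne_zero (hfac i hi))).1 ?_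
    convert hP i hi using 1
    simp only [dividedLogDeriv, Algebra.smul_def, LinearMap.mulRight_apply, map_inv₀, map_natCast]
    ring
  simpa [div_eq_mul_inv] using h (iterD_mem_span hL hy k)

theorem dividedLogDeriv_mem {L : HomLinDiffPoly K} {N : ℕ} (hL : L.HasOrder N) {y : F}
    (hy : L.eval y = 0) (hfac : ∀ i < N, (i ! : K) ≠ 0) {P : Submodule K F}
    (hP : ∀ i < N, dividedLogDeriv y i ∈ P) (k : ℕ) : dividedLogDeriv y k ∈ P := by
  have h := P.smul_mem (k ! : K)⁻¹ (iterD_div_mem hL hy hfac hP k)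
  rwa [Algebra.smul_def, map_inv₀, map_natCast, mul_comm, ← div_eq_mul_inv] at h

end DividedDerivatives

theorem natCast_factorial_ne_zero {K : Type*} [Field K] (p : ℕ) [CharP K p] {k : ℕ}
    (h : p = 0 ∨ k < p) : (k ! : K) ≠ 0 := by
  rw [Ne, CharP.cast_eq_zero_iff K p]
  rcases CharP.char_is_prime_or_zero K p with hp | hp
  · rw [hp.dvd_factorial]
    have := hp.pos
    omega
  · rw [hp, zero_dvd_iff]
    exact Nat.factorial_ne_zero k

/-! ### Power series with graded coefficients -/

section GradedPowerSeries

variable {K A ι : Type*} [Field K] [CommRing A] [Algebra K A] [Fintype ι] {x : ι → A} {w : ι → ℕ}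

theorem coeff_mul_mem_weightFiltration {c u v : ℕ} {f g : PowerSeries A}
    (hf : ∀ k, PowerSeries.coeff k f ∈ weightFiltration K x w (k * c + u + 1))
    (hg : ∀ k, PowerSeries.coeff k g ∈ weightFiltration K x w (k * c + v)) (k : ℕ) :
    PowerSeries.coeff k (f * g) ∈ weightFiltration K x w (k * c + (u + v)) := by
  rw [PowerSeries.coeff_mul]
  refine Submodule.sum_mem _ fun ij hij => ?_
  rw [Finset.HasAntidiagonal.mem_antidiagonal] at hij
  exact weightFiltration_mono (le_of_eq (by rw [← hij]; ring))
    (mul_mem_weightFiltration (hf ij.1) (hg ij.2))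

theorem coeff_pow_mem_weightFiltration {c u : ℕ} {f : PowerSeries A}
    (hf : ∀ k, PowerSeries.coeff k f ∈ weightFiltration K x w (k * c + u + 1)) (q k : ℕ) :
    PowerSeries.coeff k (f ^ q) ∈ weightFiltration K x w (k * c + q * u + 1) := by
  induction q generalizing k with
  | zero =>
    rw [pow_zero, PowerSeries.coeff_one]
    split_ifs
    · exact one_mem_weightFiltration _
    · exact Submodule.zero_mem _
  | succ q ih =>
    rw [pow_succ]
    exact weightFiltration_mono (le_of_eq (by ring))
      (coeff_mul_mem_weightFiltration (u := q * u) (v := u + 1) ih hf k)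

/-- Series with the same leading part have powers with the same leading part, by telescoping. -/
theorem coeff_pow_sub_pow_mem_weightFiltration {c u : ℕ} {f g : PowerSeries A}
    (hf : ∀ k, PowerSeries.coeff k f ∈ weightFiltration K x w (k * c + u + 1))
    (hfg : ∀ k, PowerSeries.coeff k (f - g) ∈ weightFiltration K x w (k * c + u)) (q k : ℕ) :
    PowerSeries.coeff k (f ^ q - g ^ q) ∈ weightFiltration K x w (k * c + q * u) := by
  have hg : ∀ k, PowerSeries.coeff k g ∈ weightFiltration K x w (k * c + (u + 1)) := fun k => by
    rw [← sub_sub_self f g, map_sub]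
    exact Submodule.sub_mem _ (hf k) (weightFiltration_mono (by omega) (hfg k))
  induction q generalizing k with
  | zero => simp
  | succ q ih =>
    have hsplit : f ^ (q + 1) - g ^ (q + 1) = f ^ q * (f - g) + g * (f ^ q - g ^ q) := by ring
    rw [hsplit, map_add]
    refine Submodule.add_mem _ ?_ ?_
    · exact weightFiltration_mono (le_of_eq (by ring))
        (coeff_mul_mem_weightFiltration (u := q * u) (v := u)
          (coeff_pow_mem_weightFiltration hf q) hfg k)
    · exact weightFiltration_mono (le_of_eq (by ring))
        (coeff_mul_mem_weightFiltration (u := u) (v := q * u) hg ih k)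

end GradedPowerSeries

/-! ### The degree bound for y^q -/

theorem mul_sub_sq_le {c j b : ℕ} : (c + 2 * j) * b - b ^ 2 ≤ b * c + j ^ 2 := by
  rw [Nat.sub_le_iff_le_add]
  zify
  nlinarith [sq_nonneg ((b : ℤ) - j)]

theorem mul_sub_sq_lt {c j b : ℕ} (h : b ≠ j) (hj : 0 < j) :
    (c + 2 * j) * b - b ^ 2 < b * c + j ^ 2 := by
  have h0 : 0 < b * c + j ^ 2 := by positivity
  have h1 : ((b : ℤ) - j) ≠ 0 := by rw [sub_ne_zero]; exact_mod_cast h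
  have h2 : (c + 2 * j) * b < b * c + j ^ 2 + b ^ 2 := by
    zify
    nlinarith [sq_pos_of_ne_zero h1]
  omega

/-- Linear dependence is stated through all subspaces `P` so that it can be applied directly to the
filtration steps. -/
theorem isIntegral_and_natDegree_minpoly_le_pow {K A : Type*} [Field K] [Field A] [Algebra K A]
    {n q : ℕ} {ξ : ℕ → A} (hξ0 : ξ 0 = 1)
    (hξ : ∀ P : Submodule K A, (∀ i ≤ n, ξ i ∈ P) → ∀ k, ξ k ∈ P)
    (hq : ∀ P : Submodule K A, (∀ i < q, PowerSeries.coeff i (PowerSeries.mk ξ ^ q) ∈ P) →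
      ∀ k ≤ q * n, PowerSeries.coeff k (PowerSeries.mk ξ ^ q) ∈ P)
    {z : A} (hz : ∀ P : Submodule K A, (∀ i ≤ n, ξ i ∈ P) → z ∈ P) :
    IsIntegral K z ∧ (minpoly K z).natDegree ≤ q ^ n := by
  -- Large enough that the ξ_b with b > n stay below all tangent lines used, and that coefficients
  -- of index below q are negligible.
  set M := q + 2 * (n + 1) ^ 2 with hM
  -- the weight `M j - j ^ 2` of `ξ j`
  set x : Fin n → A := fun i => ξ (i + 1)
  set w : Fin n → ℕ := fun i => M * (i + 1) - (i + 1) ^ 2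
  have hmem : ∀ i ≤ n, ξ i ∈ weightFiltration K x w (M * i - i ^ 2 + 1) := by
    intro i hi
    rcases i with _ | i
    · rw [hξ0]; exact one_mem_weightFiltration _
    · exact self_mem_weightFiltration (x := x) (w := w) ⟨i, hi⟩
  have hall : ∀ i, ξ i ∈ weightFiltration K x w (M * n + 1) :=
    hξ _ fun i hi => weightFiltration_mono
      (Nat.succ_le_succ ((Nat.sub_le _ _).trans (Nat.mul_le_mul_left _ hi))) (hmem i hi)
  have hlin : ∀ i, ξ i ∈ weightFiltration K x w (i * M + 0 + 1) := by
    intro i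
    rcases le_or_gt i n with hi | hi
    · refine weightFiltration_mono ?_ (hmem i hi)
      rw [mul_comm i]
      omega
    · refine weightFiltration_mono ?_ (hall i)
      nlinarith
  have hrel : ∀ i, x i ^ q ∈ weightFiltration K x w (q * w i) := by
    rintro ⟨i, hi⟩
    obtain ⟨j, hj⟩ : ∃ j, j = i + 1 := ⟨_, rfl⟩
    have hjM : 2 * j ≤ M := by nlinarith
    -- `c = M - 2j` is the slope at j of b ↦ Mb - b²; the tangent line b c + j² lies strictly above
    -- the weight except at b = j.
    obtain ⟨c, hc⟩ := Nat.exists_eq_add_of_le' hjM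
    have hc' : q + 2 * (n + 1) ^ 2 ≤ c + 2 * n := by omega
    have hbig : ∀ b, n < b → M * n < b * c + j ^ 2 := by
      intro b hb
      have : (n + 1) * c ≤ b * c := Nat.mul_le_mul_right c hb
      nlinarith
    have hwj : M * j - j ^ 2 = j * c + j ^ 2 := by
      rw [hc, Nat.sub_eq_iff_eq_add (by nlinarith)]
      ring
    have hweak : ∀ k, PowerSeries.coeff k (PowerSeries.mk ξ) ∈
        weightFiltration K x w (k * c + j ^ 2 + 1) := by
      intro k
      rw [PowerSeries.coeff_mk]
      rcases le_or_gt k n with hk | hk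
      · refine weightFiltration_mono ?_ (hmem k hk)
        rw [hc]
        exact Nat.succ_le_succ mul_sub_sq_le
      · exact weightFiltration_mono (by have := hbig k hk; omega) (hall k)
    have hstrict : ∀ k, PowerSeries.coeff k (PowerSeries.mk ξ - PowerSeries.monomial j (ξ j)) ∈
        weightFiltration K x w (k * c + j ^ 2) := by
      intro k
      rw [map_sub, PowerSeries.coeff_mk, PowerSeries.coeff_monomial]
      split_ifs with h
      · rw [h, sub_self]; exact Submodule.zero_mem _
      rw [sub_zero]
      rcases le_or_gt k n with hk | hk
      · refine weightFiltration_mono ?_ (hmem k hk)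
        rw [hc]
        exact mul_sub_sq_lt h (by omega)
      · exact weightFiltration_mono (hbig k hk) (hall k)
    have hpow := coeff_pow_sub_pow_mem_weightFiltration hweak hstrict q (q * j)
    rw [PowerSeries.monomial_pow, map_sub, PowerSeries.coeff_monomial, if_pos (by ring)] at hpow
    have hwi : w ⟨i, hi⟩ = j * c + j ^ 2 := by rw [← hwj, hj]
    rw [hwi, show x ⟨i, hi⟩ = ξ j by rw [hj]]
    rw [show q * j * c + q * j ^ 2 = q * (j * c + j ^ 2) by ring] at hpow
    refine (Submodule.sub_mem_iff_right _ ?_).1 hpow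
    -- Coefficient qj is a combination of those of index k < q, whose weight is at most (q - 1)M <
    -- q(M - 1).
    refine hq _ (fun k hk => ?_) _ (Nat.mul_le_mul_left q (by omega))
    have hcoe : PowerSeries.coeff k (PowerSeries.mk ξ ^ q) ∈
        weightFiltration K x w (k * M + 1) := by
      simpa using coeff_pow_mem_weightFiltration (f := PowerSeries.mk ξ) (u := 0)
        (by simpa using hlin) q k
    refine weightFiltration_mono ?_ hcoe
    have h1 : (k + 1) * M ≤ q * M := Nat.mul_le_mul_right M hk
    have h2 : M ≤ j * c + j ^ 2 + 1 := by nlinarith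
    nlinarith
  have hfin := isIntegral_and_natDegree_minpoly_le_prod hrel (hz _ fun i _ => hall i)
  simpa using hfin

/-! ### The degree bound for 1/y -/

theorem Polynomial.exists_eq_prod_one_sub_C_mul_X {Ω : Type*} [Field Ω] [IsAlgClosed Ω] (n : ℕ)
    (Q : Polynomial Ω) (h0 : Q.coeff 0 = 1) (hn : Q.natDegree ≤ n) :
    ∃ t : ℕ → Ω, Q = ∏ i ∈ Finset.range n, (1 - Polynomial.C (t i) * Polynomial.X) := by
  induction n generalizing Q with
  | zero =>
    refine ⟨0, ?_⟩
    rw [Polynomial.eq_C_of_natDegree_le_zero hn, h0]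
    simp
  | succ n ih =>
    rcases Nat.eq_zero_or_pos Q.natDegree with hd | hd
    · refine ⟨0, ?_⟩
      rw [Polynomial.eq_C_of_natDegree_eq_zero hd, h0]
      simp
    obtain ⟨α, hα⟩ := IsAlgClosed.exists_root Q
      (Polynomial.degree_pos_of_ne_zero_of_nonunit
        (fun h => by simp [h] at hd) (fun h => by
          rw [Polynomial.natDegree_eq_zero_of_isUnit h] at hd; omega)).ne'
    obtain ⟨R, rfl⟩ := Polynomial.dvd_iff_isRoot.2 hα
    have hmul : -α * R.coeff 0 = 1 := by simpa [Polynomial.mul_coeff_zero] using h0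
    have hα0 : α ≠ 0 := by rintro rfl; simp at hmul
    have hR : R ≠ 0 := by rintro rfl; simp at hmul
    obtain ⟨t, ht⟩ := ih (Polynomial.C (-α) * R) (by simpa using hmul) (by
      rw [Polynomial.natDegree_C_mul (neg_ne_zero.2 hα0)]
      rw [Polynomial.natDegree_mul (Polynomial.X_sub_C_ne_zero α) hR,
        Polynomial.natDegree_X_sub_C] at hn
      omega)
    refine ⟨fun i => if i = n then α⁻¹ else t i, ?_⟩
    rw [Finset.prod_range_succ, Finset.prod_congr rfl (g := fun i =>
      1 - Polynomial.C (t i) * Polynomial.X), ← ht]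
    · beta_reduce
      rw [if_pos rfl]
      have hC : Polynomial.C α * Polynomial.C α⁻¹ = 1 := by
        rw [← Polynomial.C_mul, mul_inv_cancel₀ hα0, Polynomial.C_1]
      rw [Polynomial.C_neg]
      linear_combination (-R * Polynomial.X) * hC
    · intro i hi
      beta_reduce
      rw [if_neg (Finset.mem_range.1 hi).ne]

theorem PowerSeries.mk_pow_mul_one_sub_C_mul_X {Ω : Type*} [CommRing Ω] (t : Ω) :
    PowerSeries.mk (fun k => t ^ k) * (1 - PowerSeries.C t * PowerSeries.X) = 1 := by
  ext k
  rw [mul_sub, mul_one, ← mul_assoc, map_sub]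
  rcases k with _ | k
  · simp
  · simp [PowerSeries.coeff_succ_mul_X, PowerSeries.coeff_one, pow_succ]

/-- The inverse of a power series with graded coefficients has graded coefficients. -/
theorem coeff_mem_weightFiltration_of_mul_eq_one {K A ι : Type*} [Field K] [CommRing A]
    [Algebra K A] [Fintype ι] {x : ι → A} {w : ι → ℕ} {f g : PowerSeries A} (hfg : f * g = 1)
    (hf0 : PowerSeries.coeff 0 f = 1)
    (hf : ∀ k, PowerSeries.coeff k f ∈ weightFiltration K x w (k + 1)) (k : ℕ) :
    PowerSeries.coeff k g ∈ weightFiltration K x w (k + 1) := by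
  induction k using Nat.strong_induction_on with
  | _ k ih =>
  have h := congrArg (PowerSeries.coeff k) hfg
  rw [PowerSeries.coeff_mul] at h
  rcases k with _ | k
  · have h' : PowerSeries.coeff 0 g = 1 := by simpa [hf0] using h
    rw [h']
    exact one_mem_weightFiltration 0
  · rw [Finset.Nat.sum_antidiagonal_succ, hf0, one_mul, PowerSeries.coeff_one,
      if_neg (Nat.succ_ne_zero k)] at h
    rw [eq_neg_of_add_eq_zero_left h]
    refine Submodule.neg_mem _ (Submodule.sum_mem _ fun ij hij => ?_)
    rw [Finset.HasAntidiagonal.mem_antidiagonal] at hij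
    exact weightFiltration_mono (by omega)
      (mul_mem_weightFiltration (hf (ij.1 + 1)) (ih ij.2 (by omega)))

theorem isIntegral_and_natDegree_minpoly_le_descFactorial {K Ω : Type*} [Field K] [Field Ω]
    [IsAlgClosed Ω] [Algebra K Ω] {n m : ℕ} (hm : 0 < m) {X R : PowerSeries Ω} (hXR : X * R = 1)
    (hX0 : PowerSeries.coeff 0 X = 1)
    (hX : ∀ P : Submodule K Ω, (∀ i ≤ n, PowerSeries.coeff i X ∈ P) →
      ∀ k, PowerSeries.coeff k X ∈ P)
    (hR : ∀ P : Submodule K Ω, (∀ i < m, PowerSeries.coeff i R ∈ P) →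
      ∀ k < m + n, PowerSeries.coeff k R ∈ P)
    {z : Ω} (hz : ∀ P : Submodule K Ω, (∀ i ≤ n, PowerSeries.coeff i X ∈ P) → z ∈ P) :
    IsIntegral K z ∧ (minpoly K z).natDegree ≤ (m + n - 1).descFactorial n := by
  obtain ⟨t, ht⟩ := Polynomial.exists_eq_prod_one_sub_C_mul_X n (PowerSeries.trunc (n + 1) X)
    (by rw [PowerSeries.coeff_trunc, if_pos (Nat.succ_pos n), hX0])
    (Nat.lt_succ_iff.1 (PowerSeries.natDegree_trunc_lt X n))
  set x : Fin n → Ω := fun i => t i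
  -- `G r` generates the complete homogeneous polynomials in t_0, …, t_{r-1}.
  set G : ℕ → PowerSeries Ω :=
    fun r => ∏ i ∈ Finset.range r, PowerSeries.mk fun k => t i ^ k with hG
  set E : PowerSeries Ω := ((PowerSeries.trunc (n + 1) X : Polynomial Ω) : PowerSeries Ω) with hE
  have hGsucc : ∀ r, G (r + 1) = G r * PowerSeries.mk fun k => t r ^ k := fun r =>
    Finset.prod_range_succ _ _
  have hE' : E = ∏ i ∈ Finset.range n, (1 - PowerSeries.C (t i) * PowerSeries.X) := by
    rw [hE, ht, ← Polynomial.coeToPowerSeries.ringHom_apply, map_prod]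
    simp
  have hGE : G n * E = 1 := by
    rw [hE', hG, ← Finset.prod_mul_distrib]
    exact Finset.prod_eq_one fun i _ => PowerSeries.mk_pow_mul_one_sub_C_mul_X (t i)
  have hEcoeff : ∀ k, PowerSeries.coeff k E = if k < n + 1 then PowerSeries.coeff k X else 0 :=
    fun k => by rw [hE, Polynomial.coeff_coe, PowerSeries.coeff_trunc]
  -- gradedness with respect to the total degree in `t`
  have htV : ∀ i < n, t i ∈ weightFiltration K x (fun _ => 1) (1 + 1) := fun i hi =>
    self_mem_weightFiltration (x := x) (w := fun _ => 1) ⟨i, hi⟩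
  have hGV : ∀ r ≤ n, ∀ k, PowerSeries.coeff k (G r) ∈
      weightFiltration K x (fun _ => 1) (k + 1) := by
    intro r
    induction r with
    | zero =>
      intro _ k
      simp only [hG, Finset.range_zero, Finset.prod_empty, PowerSeries.coeff_one]
      split_ifs
      · exact one_mem_weightFiltration _
      · exact Submodule.zero_mem _
    | succ r ih =>
      intro hr k
      rw [hGsucc]
      have h1 := coeff_mul_mem_weightFiltration (c := 1) (u := 0) (v := 1)
        (fun k => by simpa using ih (by omega) k)
        (fun k => by simpa using pow_mem_weightFiltration (htV r hr) k :
          ∀ k, PowerSeries.coeff k (PowerSeries.mk fun k => t r ^ k) ∈ _) k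
      simpa using h1
  have hGcoeff0 : ∀ r, PowerSeries.coeff 0 (G r) = 1 := fun r => by
    rw [hG, PowerSeries.coeff_zero_eq_constantCoeff_apply, map_prod]
    exact Finset.prod_eq_one fun i _ => by
      simp [← PowerSeries.coeff_zero_eq_constantCoeff_apply]
  have hEV := coeff_mem_weightFiltration_of_mul_eq_one hGE (hGcoeff0 n) (hGV n le_rfl)
  have hXle : ∀ i ≤ n, PowerSeries.coeff i X ∈ weightFiltration K x (fun _ => 1) (i + 1) :=
    fun i hi => by
      have h := hEV i
      rwa [hEcoeff, if_pos (Nat.lt_succ_of_le hi)] at h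
  have hXn : ∀ i, PowerSeries.coeff i X ∈ weightFiltration K x (fun _ => 1) (n + 1) :=
    hX _ fun i hi => weightFiltration_mono (Nat.succ_le_succ hi) (hXle i hi)
  have hXV : ∀ i, PowerSeries.coeff i X ∈ weightFiltration K x (fun _ => 1) (i + 1) := by
    intro i
    rcases le_or_gt i n with hi | hi
    · exact hXle i hi
    · exact weightFiltration_mono (by omega) (hXn i)
  have hRV := coeff_mem_weightFiltration_of_mul_eq_one hXR hX0 hXV
  have hXE : ∀ k, PowerSeries.coeff k (X - E) ∈ weightFiltration K x (fun _ => 1) (k * 1 + 0) := by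
    intro k
    rw [map_sub, hEcoeff]
    split_ifs with h
    · rw [sub_self]; exact Submodule.zero_mem _
    · rw [sub_zero]; exact weightFiltration_mono (by omega) (hXn k)
  have hGR : ∀ k, PowerSeries.coeff k (G n - R) ∈ weightFiltration K x (fun _ => 1) k := by
    intro k
    have hsplit : G n - R = G n * (R * (X - E)) := by
      linear_combination (-G n) * hXR + R * hGE
    rw [hsplit]
    have h1 := coeff_mul_mem_weightFiltration (c := 1) (u := 0) (fun k => by simpa using hRV k) hXE
    simpa using coeff_mul_mem_weightFiltration (c := 1) (u := 0)
      (fun k => by simpa using hGV n le_rfl k) h1 k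
  -- the complete homogeneous polynomials in fewer variables have smaller degree than expected
  have hGstrict : ∀ d ≤ n, ∀ k < m + n, m + d ≤ k →
      PowerSeries.coeff k (G (n - d)) ∈ weightFiltration K x (fun _ => 1) k := by
    intro d
    induction d with
    | zero =>
      intro _ k hk hmk
      refine (Submodule.sub_mem_iff_left _ ?_).1 (by simpa using hGR k)
      exact hR _ (fun i hi => weightFiltration_mono (by omega) (hRV i)) k hk
    | succ d ih =>
      intro hd k hk hmk
      obtain ⟨k, rfl⟩ := Nat.exists_eq_add_of_le' (show 1 ≤ k by omega)
      obtain ⟨r, hr⟩ : ∃ r, r = n - (d + 1) := ⟨_, rfl⟩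
      have hnd : n - d = r + 1 := by omega
      -- That is, h_k(t_0, …, t_{r-1}) = h_k(t_0, …, t_r) - t_r h_{k-1}(t_0, …, t_r); each
      -- eliminated variable costs one index.
      have hGr : G r = G (r + 1) - G (r + 1) * PowerSeries.X * PowerSeries.C (t r) := by
        rw [hGsucc]
        linear_combination (-G r) * PowerSeries.mk_pow_mul_one_sub_C_mul_X (t r)
      rw [← hr, hGr, map_sub, PowerSeries.coeff_mul_C, PowerSeries.coeff_succ_mul_X, ← hnd]
      refine Submodule.sub_mem _ (ih (by omega) _ hk (by omega)) ?_
      exact mul_mem_weightFiltration' (ih (by omega) k (by omega) (by omega)) (htV r (by omega))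
  -- refine the degree to make the leading monomials pure powers
  set M := (m + n) * n with hM
  set w : Fin n → ℕ := fun i => M + i + 1
  have htw : ∀ r (hr : r < n), t r ∈ weightFiltration K x w (M + r + 1 + 1) := fun r hr =>
    self_mem_weightFiltration (x := x) (w := w) ⟨r, hr⟩
  have hmkw : ∀ r < n, ∀ k, PowerSeries.coeff k (PowerSeries.mk fun k => t r ^ k) ∈
      weightFiltration K x w (k * (M + r + 1) + 0 + 1) := fun r hr k => by
    rw [PowerSeries.coeff_mk]
    exact pow_mem_weightFiltration (htw r hr) k
  have hlead : ∀ r < n, ∀ k,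
      (∀ k, PowerSeries.coeff k (G r) ∈ weightFiltration K x w (k * (M + r) + 1)) →
      PowerSeries.coeff k (G (r + 1) - PowerSeries.mk fun k => t r ^ k) ∈
        weightFiltration K x w (k * (M + r + 1)) := by
    intro r hr k h
    have hsplit : (G (r + 1) - PowerSeries.mk fun k => t r ^ k) =
        (PowerSeries.mk fun k => t r ^ k) * (G r - 1) := by
      rw [hGsucc]
      ring
    rw [hsplit]
    refine coeff_mul_mem_weightFiltration (u := 0) (v := 0) (hmkw r hr) (fun k => ?_) k
    rcases Nat.eq_zero_or_pos k with rfl | hk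
    · rw [map_sub, hGcoeff0]; simp
    · rw [map_sub, PowerSeries.coeff_one, if_neg hk.ne', sub_zero]
      exact weightFiltration_mono (by rw [mul_add k (M + r)]; omega) (h k)
  have hGw : ∀ r ≤ n, ∀ k, PowerSeries.coeff k (G r) ∈
      weightFiltration K x w (k * (M + r) + 1) := by
    intro r
    induction r with
    | zero =>
      intro _ k
      simp only [hG, Finset.range_zero, Finset.prod_empty, PowerSeries.coeff_one]
      split_ifs
      · exact one_mem_weightFiltration _
      · exact Submodule.zero_mem _
    | succ r ih =>
      intro hr k
      have h1 := hlead r hr k (ih (by omega))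
      rw [map_sub] at h1
      exact (Submodule.sub_mem_iff_left _ (hmkw r hr k)).1
        (weightFiltration_mono (Nat.le_succ _) h1)
  have hrel : ∀ i : Fin n, x i ^ (m + n - 1 - (i : ℕ)) ∈
      weightFiltration K x w ((m + n - 1 - (i : ℕ)) * w i) := by
    rintro ⟨i, hi⟩
    obtain ⟨k, hk⟩ : ∃ k, k = m + n - 1 - i := ⟨_, rfl⟩
    have h1 := hlead i hi k (hGw i hi.le)
    rw [map_sub, PowerSeries.coeff_mk] at h1
    rw [← hk]
    refine (Submodule.sub_mem_iff_right _ ?_).1 h1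
    have h2 := hGstrict (n - (i + 1)) (by omega) k (by omega) (by omega)
    rw [show n - (n - (i + 1)) = i + 1 by omega] at h2
    refine weightFiltration_le_of_weight (fun b hb => ?_) h2
    have h3 : ∑ j, b j * w j ≤ (∑ j, b j * 1) * (M + n) := by
      rw [Finset.sum_mul]
      refine Finset.sum_le_sum fun j _ => ?_
      rw [mul_one]
      exact Nat.mul_le_mul_left _ (by have := j.2; simp only [w]; omega)
    obtain ⟨s, hs⟩ : ∃ s, s = ∑ j, b j * 1 := ⟨_, rfl⟩
    rw [← hs] at h3 hb
    -- `M` is chosen so that total degree s < k forces weight at most s(M + n) ≤ kM, below that of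
    -- t_i^k.
    have h4 : s * n ≤ M := Nat.mul_le_mul_right n (by omega)
    have h5 : (s + 1) * M ≤ k * M := Nat.mul_le_mul_right M hb
    have h6 : k * (M + i + 1) = k * M + k * (i + 1) := by ring
    have h7 : 0 < k * (i + 1) := Nat.mul_pos (by omega) (by omega)
    rw [h6]
    nlinarith
  have hfin := isIntegral_and_natDegree_minpoly_le_prod hrel
    (hz (weightFiltration K x w (n * (M + n) + n + 1)) fun i hi =>
      weightFiltration_le_of_weight (fun b hb => ?_) (hXle i hi))
  · rwa [Fin.prod_univ_eq_prod_range (fun i => m + n - 1 - i) n,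
      ← Nat.descFactorial_eq_prod_range] at hfin
  · have h3 : ∑ j, b j * w j ≤ (∑ j, b j * 1) * (M + n) := by
      rw [Finset.sum_mul]
      refine Finset.sum_le_sum fun j _ => ?_
      rw [mul_one]
      exact Nat.mul_le_mul_left _ (by have := j.2; simp only [w]; omega)
    have h4 : (∑ j, b j * 1) * (M + n) ≤ n * (M + n) := Nat.mul_le_mul_right _ (by omega)
    omega

/-! ### Application to solutions of the equations -/

theorem coeff_inv_mk_dividedLogDeriv {F : Type*} [Field F] [Differential F] {y : F} (hy : y ≠ 0)
    {B : ℕ} (hB : ∀ k ≤ B, (k ! : F) ≠ 0) {k : ℕ} (hk : k ≤ B) :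
    PowerSeries.coeff k (PowerSeries.mk (dividedLogDeriv y))⁻¹ = dividedLogDeriv y⁻¹ k := by
  have hunit : PowerSeries.mk (dividedLogDeriv y) * (PowerSeries.mk (dividedLogDeriv y))⁻¹ = 1 :=
    PowerSeries.mul_inv_cancel _ (by
      rw [← PowerSeries.coeff_zero_eq_constantCoeff_apply, PowerSeries.coeff_mk,
        dividedLogDeriv_zero hy]
      exact one_ne_zero)
  -- The product is 1 only modulo T^(B+1), since later factorials may vanish.
  have hdvd : PowerSeries.X ^ (B + 1) ∣
      PowerSeries.mk (dividedLogDeriv y) * PowerSeries.mk (dividedLogDeriv y⁻¹) - 1 := by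
    refine PowerSeries.X_pow_dvd_iff.2 fun i hi => ?_
    have h := dividedLogDeriv_mul hy (inv_ne_zero hy) (hB i (by omega))
    rw [mul_inv_cancel₀ hy] at h
    rw [map_sub, PowerSeries.coeff_mul, PowerSeries.coeff_one]
    simp only [PowerSeries.coeff_mk]
    rw [← h]
    split_ifs with hi0
    · rw [hi0, dividedLogDeriv_zero one_ne_zero, sub_self]
    · rw [dividedLogDeriv_one hi0, sub_self]
  have hsub : PowerSeries.mk (dividedLogDeriv y⁻¹) - (PowerSeries.mk (dividedLogDeriv y))⁻¹ =
      (PowerSeries.mk (dividedLogDeriv y))⁻¹ *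
        (PowerSeries.mk (dividedLogDeriv y) * PowerSeries.mk (dividedLogDeriv y⁻¹) - 1) := by
    linear_combination (-PowerSeries.mk (dividedLogDeriv y⁻¹)) * hunit
  have hcoeff := PowerSeries.X_pow_dvd_iff.1 (hsub ▸ hdvd.mul_left _) k (by omega)
  rw [map_sub, PowerSeries.coeff_mk, sub_eq_zero] at hcoeff
  exact hcoeff.symm

section

variable {K F : Type*} [Field K] [Differential K] [Field F] [Differential F]
  [Algebra K F] [DifferentialAlgebra K F]

theorem isIntegral_iterD_div_of_eval_inv {n m : ℕ} (hm : 0 < m)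
    (hfac : ∀ k < m + n, (k ! : K) ≠ 0) {L₁ L₂ : HomLinDiffPoly K} (hL₁ : L₁.HasOrder (n + 1))
    (hL₂ : L₂.HasOrder m) {y : F} (hy : y ≠ 0) (h₁ : L₁.eval y = 0) (h₂ : L₂.eval y⁻¹ = 0)
    (j : ℕ) : IsIntegral K (iterD j y / y) ∧
      (minpoly K (iterD j y / y)).natDegree ≤ (m + n - 1).descFactorial n := by
  let Ω := AlgebraicClosure F
  have hfacF : ∀ k ≤ m + n - 1, (k ! : F) ≠ 0 := fun k hk => by
    rw [← map_natCast (algebraMap K F)]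
    exact (map_ne_zero _).2 (hfac k (by omega))
  set X : PowerSeries F := PowerSeries.mk (dividedLogDeriv y)
  have hX0 : PowerSeries.coeff 0 X = 1 := by
    rw [PowerSeries.coeff_mk, dividedLogDeriv_zero hy]
  have hXR : X * X⁻¹ = 1 := PowerSeries.mul_inv_cancel _ (by
    rw [← PowerSeries.coeff_zero_eq_constantCoeff_apply, hX0]
    exact one_ne_zero)
  let emb : F →ₗ[K] Ω := (IsScalarTower.toAlgHom K F Ω).toLinearMap
  have hemb : ∀ k (f : PowerSeries F),
      PowerSeries.coeff k (PowerSeries.map (algebraMap F Ω) f) = emb (PowerSeries.coeff k f) :=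
    fun k f => PowerSeries.coeff_map _ _ _
  have hmain := isIntegral_and_natDegree_minpoly_le_descFactorial (K := K) (n := n) hm
    (X := PowerSeries.map (algebraMap F Ω) X) (R := PowerSeries.map (algebraMap F Ω) X⁻¹)
    (z := emb (iterD j y / y)) (by rw [← map_mul, hXR, map_one])
    (by rw [PowerSeries.coeff_map, hX0, map_one])
    (fun P hP k => by
      rw [hemb, PowerSeries.coeff_mk]
      refine dividedLogDeriv_mem (P := P.comap emb) hL₁ h₁ (fun i hi => hfac i (by omega))
        (fun i hi => ?_) k
      have h := hP i (by omega)
      rwa [hemb, PowerSeries.coeff_mk] at h)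
    (fun P hP k hk => by
      rw [hemb, coeff_inv_mk_dividedLogDeriv hy hfacF (by omega)]
      refine dividedLogDeriv_mem (P := P.comap emb) hL₂ h₂ (fun i hi => hfac i (by omega))
        (fun i hi => ?_) k
      have h := hP i hi
      rwa [hemb, coeff_inv_mk_dividedLogDeriv hy hfacF (by omega)] at h)
    (fun P hP => by
      refine iterD_div_mem (P := P.comap emb) hL₁ h₁ (fun i hi => hfac i (by omega))
        (fun i hi => ?_) j
      have h := hP i (by omega)
      rwa [hemb, PowerSeries.coeff_mk] at h)
  have hinj : Function.Injective (algebraMap F Ω) := (algebraMap F Ω).injective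
  change IsIntegral K (algebraMap F Ω _) ∧ (minpoly K (algebraMap F Ω _)).natDegree ≤ _ at hmain
  rwa [minpoly.algebraMap_eq hinj, isIntegral_algebraMap_iff hinj] at hmain

theorem isIntegral_iterD_div_of_eval_pow {n m q : ℕ} (hn : 0 < n) (hq : 0 < q) (hmq : m ≤ q)
    (hfac : ∀ k < q * n + n, (k ! : K) ≠ 0) {L₁ L₂ : HomLinDiffPoly K}
    (hL₁ : L₁.HasOrder (n + 1)) (hL₂ : L₂.HasOrder m) {y : F} (hy : y ≠ 0) (h₁ : L₁.eval y = 0)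
    (h₂ : L₂.eval (y ^ q) = 0) (j : ℕ) : IsIntegral K (iterD j y / y) ∧
      (minpoly K (iterD j y / y)).natDegree ≤ q ^ n := by
  have hqn : q ≤ q * n := Nat.le_mul_of_pos_right q hn
  have hnq : n ≤ q * n := Nat.le_mul_of_pos_left n hq
  have hfacF : ∀ k ≤ q * n, (k ! : F) ≠ 0 := fun k hk => by
    rw [← map_natCast (algebraMap K F)]
    exact (map_ne_zero _).2 (hfac k (by omega))
  refine isIntegral_and_natDegree_minpoly_le_pow (ξ := dividedLogDeriv y)
    (dividedLogDeriv_zero hy) (fun P hP k => ?_) (fun P hP k hk => ?_) (fun P hP => ?_)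
  · exact dividedLogDeriv_mem hL₁ h₁ (fun i hi => hfac i (by omega)) (fun i hi => hP i (by omega)) k
  · rw [← dividedLogDeriv_pow hy hfacF q hk]
    refine dividedLogDeriv_mem hL₂ h₂ (fun i hi => hfac i (by omega)) (fun i hi => ?_) k
    rw [dividedLogDeriv_pow hy hfacF q (by omega)]
    exact hP i (by omega)
  · exact iterD_div_mem hL₁ h₁ (fun i hi => hfac i (by omega)) (fun i hi => hP i (by omega)) j

end

/-- In both bounds the quotient of factorials is exact, so that natural-number division is
the usual quotient. -/
theorem theorem1p2 {K F : Type*} [Field K] [Differential K] [Field F] [Differential F]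
    [Algebra K F] [DifferentialAlgebra K F] (p : ℕ) [CharP K p]
    (N₁ N₂ : ℕ) (hN₁ : 1 < N₁) (hN₂ : 1 < N₂)
    (L₁ L₂ : HomLinDiffPoly K) (hL₁ : L₁.HasOrder N₁) (hL₂ : L₂.HasOrder N₂)
    (y : F) (hy : y ≠ 0) :
    ((p = 0 ∨ N₁ + N₂ - 2 < p) → L₁.eval y = 0 → L₂.eval (1 / y) = 0 →
      (∀ j : ℕ, 1 ≤ j → IsAlgebraic K (iterD j y / y)) ∧
      (∀ j : ℕ, 1 ≤ j → j ≤ N₁ - 1 →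
        (minpoly K (iterD j y / y)).natDegree ≤ (N₂ + N₁ - 2)! / (N₂ - 1)!)) ∧
    (∀ q : ℕ, (p = 0 ∨ (q + 1) * (N₁ - 1) - 1 < p) → N₂ ≤ q →
      L₁.eval y = 0 → L₂.eval (y ^ q) = 0 →
      (∀ j : ℕ, 1 ≤ j → IsAlgebraic K (iterD j y / y)) ∧
      (∀ j : ℕ, 1 ≤ j → j ≤ N₁ - 1 →
        (minpoly K (iterD j y / y)).natDegree ≤
          (q * (N₁ - 1) + N₁ - 2)! / (q * (N₁ - 1) - 1)!)) := by
  obtain ⟨n, rfl⟩ := Nat.exists_eq_add_of_le' hN₁.le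
  have hn : 0 < n := by omega
  refine ⟨fun hp h₁ h₂ => ?_, fun q hp hq h₁ h₂ => ?_⟩
  · rw [one_div] at h₂
    have hmain := isIntegral_iterD_div_of_eval_inv (by omega)
      (fun k hk => natCast_factorial_ne_zero (K := K) p (by omega)) hL₁ hL₂ hy h₁ h₂
    refine ⟨fun j _ => (hmain j).1.isAlgebraic, fun j _ _ => (hmain j).2.trans_eq ?_⟩
    rw [Nat.descFactorial_eq_div (by omega)]
    congr 2
    omega
  · rw [Nat.add_sub_cancel, Nat.succ_mul] at hp
    have hmain := isIntegral_iterD_div_of_eval_pow hn (by omega) hq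
      (fun k hk => natCast_factorial_ne_zero (K := K) p (by omega)) hL₁ hL₂ hy h₁ h₂
    refine ⟨fun j _ => (hmain j).1.isAlgebraic, fun j _ _ => (hmain j).2.trans ?_⟩
    have hqn : q ≤ q * n := Nat.le_mul_of_pos_right q hn
    rw [Nat.add_sub_cancel, show q * n + (n + 1) - 2 = q * n + n - 1 by omega,
      show q * n - 1 = q * n + n - 1 - n by omega, ← Nat.descFactorial_eq_div (by omega)]
    -- All n factors of the descending factorial are at least qn ≥ q.
    refine le_trans (Nat.pow_le_pow_left ?_ n) (Nat.pow_sub_le_descFactorial _ n)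
    omega
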